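/- Let $k\ge 2$ be an integer. A sequence $(a_n)_{n\ge 0}$ with values in a finite set is $k$-automatic if there is a deterministic finite automaton with output which, for every $n$, on reading any base-$k$ representation of $n$ (least significant digit first, leading zeros allowed) stops in a state with output $a_n$. An irrational real number is said to have a $k$-automatic continued fraction expansion if its regular continued fraction expansion $[a_0,a_1,a_2,\ldots]$ has bounded partial quotients and the sequence $(a_n)_{n\ge 0}$ is $k$-automatic. Let $\alpha$ be an irrational real number with a $k$-automatic continued fraction expansion $[a_0,a_1,a_2,\ldots]$, and let $p_n/q_n=[a_0,a_1,\ldots,a_n]$ be its $n$-th convergent. Put $$\beta=\liminf_{n\to\infty}\frac{p_n}{p_{n-1}},\qquad \gamma=\liminf_{n\to\infty}\frac{q_n}{q_{n-1}},\qquad \delta=\limsup_{n\to\infty}\frac{p_n}{p_{n-1}},\qquad \zeta=\limsup_{n\to\infty}\frac{q_n}{q_{n-1}}.$$ Then $\beta,\gamma,\delta,\zeta$ are irrational real numbers, and each of them has a $k$-automatic continued fraction expansion. -/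

import Mathlib

open Filter

/-- A deterministic finite automaton with output (DFAO) with input alphabet `{0, …, k - 1}`,
state set `Q` and outputs in `Δ`. Finiteness of `Q` is required where the structure is used. -/
structure DFAO (k : ℕ) (Q : Type) (Δ : Type*) where
  /-- the transition function -/
  step : Q → Fin k → Q
  /-- the initial state -/
  start : Q
  /-- the output function -/
  output : Q → Δ

namespace DFAO

/-- The output of the automaton after reading the word `w` from left to right. -/
def run {k : ℕ} {Q : Type} {Δ : Type*} (M : DFAO k Q Δ) (w : List (Fin k)) : Δ :=
  M.output (w.foldl M.step M.start)

end DFAO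

/-- The sequence `a` is `k`-automatic: some DFAO with finitely many states outputs `a n` on every
base-`k` representation of `n`, read with the least significant digit first, where any number of
leading zeros (the last letters read) is allowed. `Nat.ofDigits` takes the least significant digit
first. Since there are finitely many states, `a` takes finitely many values. -/
def IsAutomatic (k : ℕ) {Δ : Type*} (a : ℕ → Δ) : Prop :=
  ∃ (Q : Type) (_ : Finite Q) (M : DFAO k Q Δ),
    ∀ (n : ℕ) (w : List (Fin k)),
      Nat.ofDigits k (w.map (fun d => (d : ℕ))) = n → a n = M.run w

/-- The sequence `a` is the sequence of partial quotients of the (infinite) regular continued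
fraction expansion `[a 0, a 1, a 2, …]` of `x`. No such sequence exists for rational `x`. -/
def IsPartialQuotients (x : ℝ) (a : ℕ → ℤ) : Prop :=
  (GenContFract.of x).h = a 0 ∧
    ∀ n : ℕ, (GenContFract.of x).partDens.get? n = some ((a (n + 1) : ℤ) : ℝ)

/-- `x` has a `k`-automatic continued fraction expansion: its expansion is infinite, with bounded
partial quotients that form a `k`-automatic sequence. -/
def HasAutomaticContFract (k : ℕ) (x : ℝ) : Prop :=
  ∃ a : ℕ → ℤ, IsPartialQuotients x a ∧ (∃ B : ℤ, ∀ n, |a n| ≤ B) ∧ IsAutomatic k a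

open Topology

/-!
The ratios `y i = q i / q (i - 1)` satisfy `y i = a i + 1 / y (i - 1)`, so `y i` is the finite
continued fraction `[a i, a (i - 1), …, a 1]`. Along an ultrafilter `U` tending to infinity the
bounded sequences `i ↦ y (i - t)` and `i ↦ a (i - t)` converge, to `X t` and `b t` say, and the
limits satisfy `X t = b t + 1 / X (t + 1)` with `X t > 1`. Hence `X 0` has the partial quotients
`b` (`ReversedQuotients.exists_limit`, `IsCompleteQuotients.isPartialQuotients`), and every cluster
point of `y` arises in this way.

Continued fractions are strictly monotone for the alternating lexicographic order of their partial
quotients (`IsCompleteQuotients.lt_of_altLT`). If `X 0` is the limsup of `y`, then each word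
`b 0 … b n` is therefore the largest, in that order, among the words `a i, a (i - 1), …, a (i - n)`
that occur for arbitrarily large `i`; for the liminf it is the smallest. This determines `b` by a
formula in `a`, quantifiers over `ℕ`, addition and parity, and Büchi's theorem says that a sequence
so defined from a `k`-automatic sequence is `k`-automatic (`isAutomatic_of_extremal`).

The needed part of Büchi's theorem is proved without automata: a function on tuples of naturals is
called recognizable if it lies in a finite set of functions closed under the substitutions
`x ↦ k * x + r`. Projection is the subset construction, which is short in this language and meets no
difficulty with leading zeros (`Recog.ex`).

Since `p n / q n` tends to `α ≠ 0`, the ratios `p (n + 1) / p n` and `q (n + 1) / q n` differ by a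
null sequence, so the numerators give the same two limits as the denominators.
-/

/-! ### Recognizable functions of several natural numbers -/

/-- A function of a tuple of natural numbers is `k`-recognizable if its `k`-kernel is finite: it
belongs to a finite set of functions that is closed under `g ↦ (x ↦ g (k * x + r))` for all digit
tuples `r`. The arguments are indexed by a type `ι`; relations are the case `Δ = Prop`. -/
def Recog (k : ℕ) {ι Δ : Type*} (f : (ι → ℕ) → Δ) : Prop :=
  ∃ F : Set ((ι → ℕ) → Δ), F.Finite ∧ f ∈ F ∧
    ∀ g ∈ F, ∀ r : ι → Fin k, (fun x => g (fun i => k * x i + r i)) ∈ F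

namespace Recog

variable {k : ℕ} {ι Δ Δ₁ Δ₂ : Type*}

theorem const (c : Δ) : Recog k (fun _ : ι → ℕ => c) :=
  ⟨{fun _ => c}, Set.finite_singleton _, rfl, by rintro _ rfl r; rfl⟩

theorem map₂ (h : Δ₁ → Δ₂ → Δ) {f : (ι → ℕ) → Δ₁} {g : (ι → ℕ) → Δ₂}
    (hf : Recog k f) (hg : Recog k g) : Recog k (fun x => h (f x) (g x)) := by
  obtain ⟨F, hF, hfF, hFs⟩ := hf
  obtain ⟨G, hG, hgG, hGs⟩ := hg
  refine ⟨Set.image2 (fun u v x => h (u x) (v x)) F G, hF.image2 _ hG, ⟨f, hfF, g, hgG, rfl⟩, ?_⟩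
  rintro _ ⟨u, hu, v, hv, rfl⟩ r
  exact ⟨_, hFs u hu r, _, hGs v hv r, rfl⟩

theorem map (h : Δ₁ → Δ) {f : (ι → ℕ) → Δ₁} (hf : Recog k f) : Recog k (fun x => h (f x)) :=
  map₂ (fun u _ => h u) hf hf

theorem and {P Q : (ι → ℕ) → Prop} (hP : Recog k P) (hQ : Recog k Q) :
    Recog k (fun x => P x ∧ Q x) := map₂ And hP hQ

theorem or {P Q : (ι → ℕ) → Prop} (hP : Recog k P) (hQ : Recog k Q) :
    Recog k (fun x => P x ∨ Q x) := map₂ Or hP hQ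

theorem imp {P Q : (ι → ℕ) → Prop} (hP : Recog k P) (hQ : Recog k Q) :
    Recog k (fun x => P x → Q x) := map₂ (fun p q => p → q) hP hQ

theorem not {P : (ι → ℕ) → Prop} (hP : Recog k P) : Recog k (fun x => ¬ P x) := map Not hP

/-- Recognizable relations are closed under projection. The variable bound by the quantifier is
the argument `none`. The kernel of the projection consists of the unions of projections of members
of the kernel of `R`, as in the determinization of an automaton. -/
theorem ex (hk : 0 < k) {R : (ι → ℕ) → ℕ → Prop}
    (h : Recog k (fun x : Option ι → ℕ => R (fun i => x (some i)) (x none))) :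
    Recog k (fun x => ∃ y, R x y) := by
  obtain ⟨F, hF, hRF, hFs⟩ := h
  let ext (x : ι → ℕ) (y : ℕ) : Option ι → ℕ := fun o => o.elim y x
  let proj (s : Set ((Option ι → ℕ) → Prop)) : (ι → ℕ) → Prop :=
    fun x => ∃ A ∈ s, ∃ y, A (ext x y)
  refine ⟨proj '' 𝒫 F, hF.finite_subsets.image _,
    ⟨_, Set.singleton_subset_iff.2 hRF, ?_⟩, ?_⟩
  · funext x
    simp [proj, ext]
  · rintro _ ⟨s, hs, rfl⟩ r
    refine ⟨{B | ∃ A ∈ s, ∃ d : Fin k,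
      B = fun x => A (fun o => k * x o + (o.elim d r : Fin k))}, ?_, ?_⟩
    · rintro _ ⟨A, hA, d, rfl⟩
      exact hFs A (hs hA) (fun o => o.elim d r)
    · funext x
      have key : ∀ (y : ℕ) (d : Fin k), (fun o => k * ext x y o + (o.elim d r : Fin k)) =
          ext (fun i => k * x i + r i) (k * y + d) := by
        intro y d; funext o; cases o <;> rfl
      refine propext ⟨?_, ?_⟩
      · rintro ⟨_, ⟨A, hA, d, rfl⟩, y, hy⟩
        rw [key] at hy
        exact ⟨A, hA, _, hy⟩
      · rintro ⟨A, hA, y, hy⟩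
        refine ⟨_, ⟨A, hA, ⟨y % k, Nat.mod_lt _ hk⟩, rfl⟩, y / k, ?_⟩
        rw [key]
        simpa only [Nat.div_add_mod] using hy

theorem all (hk : 0 < k) {R : (ι → ℕ) → ℕ → Prop}
    (h : Recog k (fun x : Option ι → ℕ => R (fun i => x (some i)) (x none))) :
    Recog k (fun x => ∀ y, R x y) := by
  simpa only [not_exists, not_not] using (ex hk (R := fun x y => ¬ R x y) h.not).not

theorem add_eq (hk : 0 < k) (i j l : ι) : Recog k (fun x : ι → ℕ => x i + x j = x l) := by
  -- Schoolbook addition: the kernel consists of the two carry states and a failure state.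
  let carry (c : ℕ) : (ι → ℕ) → Prop := fun x => x i + x j + c = x l
  refine ⟨{carry 0, carry 1, fun _ => False}, Set.toFinite _, Or.inl rfl, ?_⟩
  have step : ∀ c ≤ 1, ∀ r : ι → Fin k, (fun x => carry c (fun i => k * x i + r i)) ∈
      ({carry 0, carry 1, fun _ => False} : Set ((ι → ℕ) → Prop)) := by
    intro c hc r
    have hi := (r i).2
    have hj := (r j).2
    have hl := (r l).2
    have uniq : ∀ u v : ℕ, ∀ e < k, k * u + e = k * v + r l ↔ u = v ∧ e = r l := by
      intro u v e he
      refine ⟨fun h => ?_, fun h => by rw [h.1, h.2]⟩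
      have h1 := congrArg (· / k) h
      simp only [Nat.mul_add_div hk, Nat.div_eq_of_lt he, Nat.div_eq_of_lt hl, add_zero] at h1
      subst h1
      exact ⟨rfl, by omega⟩
    have shape : ∀ c' : ℕ, ∀ e < k, (r i : ℕ) + r j + c = k * c' + e →
        (fun x => carry c (fun i => k * x i + r i)) =
          if e = r l then carry c' else fun _ => False := by
      intro c' e he h
      funext x
      have : carry c (fun i => k * x i + r i) ↔ k * (x i + x j + c') + e = k * x l + r l := by
        simp only [carry, mul_add]
        constructor <;> intro h' <;> omega
      rw [propext (this.trans (uniq _ _ e he))]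
      split_ifs with h' <;> simp [carry, h']
    by_cases h : (r i : ℕ) + r j + c < k
    · rw [shape 0 _ h (by simp)]
      split_ifs <;> simp
    · rw [shape 1 ((r i : ℕ) + r j + c - k) (by omega) (by omega)]
      split_ifs <;> simp
  rintro _ (rfl | rfl | rfl) r
  · exact step 0 zero_le_one r
  · exact step 1 le_rfl r
  · exact Or.inr (Or.inr rfl)

theorem le (hk : 0 < k) (i j : ι) : Recog k (fun x : ι → ℕ => x i ≤ x j) := by
  simp only [le_iff_exists_add, eq_comm (a := _) (b := _ + _)]
  exact ex hk (add_eq hk (some i) none (some j))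

theorem lt (hk : 0 < k) (i j : ι) : Recog k (fun x : ι → ℕ => x i < x j) := by
  simpa only [not_le] using (le hk j i).not

theorem even (hk : 0 < k) (i : ι) : Recog k (fun x : ι → ℕ => Even (x i)) := by
  simp only [Even, eq_comm (a := _) (b := _ + _)]
  exact ex hk (add_eq hk none none (some i))

theorem sub_eq (hk : 0 < k) (i j l : ι) : Recog k (fun x : ι → ℕ => x l = x i - x j) := by
  -- `x l + x l = x l` says that `x l = 0`, the value of a truncated subtraction.
  have h : (fun x : ι → ℕ => x l = x i - x j) =
      fun x => x l + x j = x i ∨ (x i ≤ x j ∧ x l + x l = x l) := by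
    funext x
    exact propext (by omega)
  rw [h]
  exact (add_eq hk _ _ _).or ((le hk _ _).and (add_eq hk _ _ _))

theorem sum {κ : Type*} (S : Finset κ) {f : κ → (ι → ℕ) → ℤ} (h : ∀ c, Recog k (f c)) :
    Recog k (fun x => ∑ c ∈ S, f c x) := by
  classical
  induction S using Finset.induction_on with
  | empty => simpa using const (0 : ℤ)
  | insert c S hc ih =>
    simp only [Finset.sum_insert hc]
    exact map₂ (· + ·) (h c) ih

theorem of_eq {f : (ι → ℕ) → ℤ} (hf : (Set.range f).Finite)
    (h : ∀ c, Recog k (fun x => f x = c)) : Recog k f := by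
  classical
  have hsum : f = fun x => ∑ c ∈ hf.toFinset, if f x = c then c else 0 := by
    funext x
    rw [Finset.sum_ite_eq, if_pos (by simp)]
  rw [hsum]
  refine sum _ fun c => ?_
  convert (h c).map fun P => if P then c else 0

end Recog

/-! ### Automatic sequences and recognizability -/

/-- In the definition of `IsAutomatic` the digits of `w` are cast to `ℕ` by a monadic lift of the
list; here this is replaced by `List.map`, and the value `n` is eliminated. -/
theorem isAutomatic_iff {k : ℕ} {Δ : Type*} {a : ℕ → Δ} : IsAutomatic k a ↔
    ∃ (Q : Type) (_ : Finite Q) (M : DFAO k Q Δ),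
      ∀ w : List (Fin k), a (Nat.ofDigits k (w.map Fin.val)) = M.run w := by
  have h : ∀ w : List (Fin k), (w.map (fun d => (d : ℕ)) : List ℕ) = w.map Fin.val := by
    intro w
    induction w with
    | nil => rfl
    | cons d w ih => simpa using ih
  simp only [IsAutomatic, h]
  exact exists_congr fun Q => exists_congr fun _ => exists_congr fun M =>
    ⟨fun H w => H _ w rfl, by rintro H _ w rfl; exact H w⟩

theorem exists_ofDigits_eq {k : ℕ} (hk : 2 ≤ k) (n : ℕ) :
    ∃ w : List (Fin k), Nat.ofDigits k (w.map Fin.val) = n := by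
  refine ⟨(Nat.digits k n).pmap Fin.mk (fun d hd => Nat.digits_lt_base (by omega) hd), ?_⟩
  rw [List.map_pmap]
  simp [Nat.ofDigits_digits]

theorem IsAutomatic.finite_range {k : ℕ} (hk : 2 ≤ k) {Δ : Type*} {a : ℕ → Δ}
    (h : IsAutomatic k a) : (Set.range a).Finite := by
  obtain ⟨Q, _, M, hM⟩ := isAutomatic_iff.1 h
  refine (Set.finite_range M.output).subset ?_
  rintro _ ⟨n, rfl⟩
  obtain ⟨w, rfl⟩ := exists_ofDigits_eq hk n
  exact ⟨_, (hM w).symm⟩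

/-- An automatic sequence has a finite kernel. Its members are indexed by the words `u` read so
far, and depend only on the state that `u` leads to. -/
theorem IsAutomatic.recog {k : ℕ} (hk : 2 ≤ k) {Δ ι : Type*} {a : ℕ → Δ} (h : IsAutomatic k a)
    (i : ι) : Recog k (fun x : ι → ℕ => a (x i)) := by
  obtain ⟨Q, _, M, hM⟩ := isAutomatic_iff.1 h
  choose D hD using exists_ofDigits_eq hk
  let g (u : List (Fin k)) : (ι → ℕ) → Δ :=
    fun x => a (Nat.ofDigits k (u.map Fin.val) + k ^ u.length * x i)
  refine ⟨Set.range g, ?_, ⟨[], by simp [g]⟩, ?_⟩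
  · refine (Set.finite_range
      (fun (s : Q) (x : ι → ℕ) => M.output ((D (x i)).foldl M.step s))).subset ?_
    rintro _ ⟨u, rfl⟩
    refine ⟨u.foldl M.step M.start, ?_⟩
    funext x
    have := hM (u ++ D (x i))
    rw [List.map_append, Nat.ofDigits_append, hD, List.length_map] at this
    simp only [g, this, DFAO.run, List.foldl_append]
  · rintro _ ⟨u, rfl⟩ r
    refine ⟨u ++ [r i], ?_⟩
    funext x
    simp only [g, List.map_append, Nat.ofDigits_append, List.length_map, List.length_append]
    congr 1
    simp [pow_succ]
    ring

/-- A sequence with finite kernel is automatic: the kernel is the state set, and a state outputs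
its value at `0`. -/
theorem Recog.isAutomatic {k : ℕ} {a : ℕ → ℤ} (h : Recog k (fun x : Unit → ℕ => a (x ()))) :
    IsAutomatic k a := by
  obtain ⟨F, hF, haF, hFs⟩ := h
  let M : DFAO k F ℤ :=
    { step := fun g d => ⟨_, hFs g.1 g.2 (fun _ => d)⟩
      start := ⟨_, haF⟩
      output := fun g => g.1 (fun _ => 0) }
  refine isAutomatic_iff.2 ⟨F, hF.to_subtype, M, ?_⟩
  have key : ∀ (w : List (Fin k)) (g : F), M.output (w.foldl M.step g) =
      g.1 (fun _ => Nat.ofDigits k (w.map Fin.val)) := by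
    intro w
    induction w with
    | nil => intro g; simp [M]
    | cons d w ih =>
      intro g
      rw [List.foldl_cons, ih]
      simp [M, Nat.ofDigits_cons, add_comm]
  exact fun w => (key w M.start).symm

/-! ### Alternating lexicographic order and extremal reversed words -/

/-- The alternating lexicographic order on the words `u 0 … u n` and `v 0 … v n` with respect to the
relation `r` on letters: at the first index where they differ, the letters compare by `r` if the
index is even, and by the converse of `r` if it is odd. -/
def AltLT (r : ℤ → ℤ → Prop) (n : ℕ) (u v : ℕ → ℤ) : Prop :=
  ∃ t, t ≤ n ∧ (∀ s, s < t → u s = v s) ∧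
    ((Even t ∧ r (u t) (v t)) ∨ (¬ Even t ∧ r (v t) (u t)))

theorem AltLT.trichotomy (r : ℤ → ℤ → Prop) (hr : ∀ x y, r x y ∨ x = y ∨ r y x) (n : ℕ)
    (u v : ℕ → ℤ) : AltLT r n u v ∨ (∀ s ≤ n, u s = v s) ∨ AltLT r n v u := by
  by_cases h : ∀ s ≤ n, u s = v s
  · exact Or.inr (Or.inl h)
  · have hex : ∃ s, s ≤ n ∧ u s ≠ v s := by push Not at h; exact h
    classical
    obtain ⟨hle, hne⟩ := Nat.find_spec hex
    have hmin : ∀ s, s < Nat.find hex → u s = v s := fun s hs => by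
      by_contra hne'
      exact Nat.find_min hex hs ⟨by omega, hne'⟩
    have hmin' : ∀ s, s < Nat.find hex → v s = u s := fun s hs => (hmin s hs).symm
    rcases hr (u (Nat.find hex)) (v (Nat.find hex)) with h1 | h1 | h1
    · by_cases hev : Even (Nat.find hex)
      · exact Or.inl ⟨_, hle, hmin, Or.inl ⟨hev, h1⟩⟩
      · exact Or.inr (Or.inr ⟨_, hle, hmin', Or.inr ⟨hev, h1⟩⟩)
    · exact absurd h1 hne
    · by_cases hev : Even (Nat.find hex)
      · exact Or.inr (Or.inr ⟨_, hle, hmin', Or.inl ⟨hev, h1⟩⟩)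
      · exact Or.inl ⟨_, hle, hmin, Or.inr ⟨hev, h1⟩⟩

theorem AltLT.congr {r : ℤ → ℤ → Prop} {n : ℕ} {u u' v v' : ℕ → ℤ} (hu : ∀ s ≤ n, u s = u' s)
    (hv : ∀ s ≤ n, v s = v' s) (h : AltLT r n u v) : AltLT r n u' v' := by
  obtain ⟨t, ht, hs, h⟩ := h
  refine ⟨t, ht, fun s hst => ?_, ?_⟩
  · rw [← hu s (by omega), ← hv s (by omega), hs s hst]
  · rwa [← hu t ht, ← hv t ht]

/-- Let `b` be a sequence whose prefixes all occur, reversed, arbitrarily far in the automatic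
sequence `a`, and such that from some point on no reversed word of `a` of a given length exceeds the
prefix of `b`. Then `b` is automatic, because this extremality is expressed by a first-order formula.
The truncation in `a (i - s)` is harmless, since only large `i` matter. -/
theorem isAutomatic_of_extremal {k : ℕ} (hk : 2 ≤ k) {a b : ℕ → ℤ} (ha : IsAutomatic k a)
    (r : ℤ → ℤ → Prop) (hr : ∀ x y, r x y ∨ x = y ∨ r y x)
    (h₁ : ∀ n N, ∃ i, N ≤ i ∧ ∀ s ≤ n, a (i - s) = b s)
    (h₂ : ∀ n, ∃ M, ∀ j, M ≤ j → ¬ AltLT r n b (fun s => a (j - s))) :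
    IsAutomatic k b := by
  have hk0 : 0 < k := by omega
  have key : ∀ n c, b n = c ↔ ∀ N, ∃ i, N ≤ i ∧ a (i - n) = c ∧ ∃ M, ∀ j, M ≤ j →
      ¬ ∃ t, t ≤ n ∧ (∀ s, s < t → a (i - s) = a (j - s)) ∧
        ((Even t ∧ r (a (i - t)) (a (j - t))) ∨ (¬ Even t ∧ r (a (j - t)) (a (i - t)))) := by
    intro n c
    obtain ⟨M, hM⟩ := h₂ n
    constructor
    · rintro rfl N
      obtain ⟨i, hi, hib⟩ := h₁ n N
      refine ⟨i, hi, hib n le_rfl, M, fun j hj h => hM j hj ?_⟩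
      exact AltLT.congr (u := fun s => a (i - s)) hib (fun _ _ => rfl) h
    · intro h
      obtain ⟨i, hi, rfl, M', hM'⟩ := h M
      obtain ⟨j, hj, hjb⟩ := h₁ n M'
      rcases AltLT.trichotomy r hr n b (fun s => a (i - s)) with h | h | h
      · exact absurd h (hM i hi)
      · exact h n le_rfl
      · exact absurd (AltLT.congr (fun _ _ => rfl) (fun s hs => (hjb s hs).symm) h) (hM' j hj)
  have hfin := ha.finite_range hk
  have hval : ∀ {ι : Type} (i j : ι), Recog k (fun x : ι → ℕ => a (x i - x j)) := by
    intro ι i j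
    refine .of_eq (hfin.subset ?_) fun c => ?_
    · rintro _ ⟨x, rfl⟩
      exact ⟨_, rfl⟩
    · have := Recog.ex hk0 (R := fun (x : ι → ℕ) y => y = x i - x j ∧ a y = c)
        ((Recog.sub_eq hk0 _ _ _).and ((ha.recog hk none).map (· = c)))
      simpa only [exists_eq_left] using this
  refine Recog.isAutomatic (.of_eq (hfin.subset ?_) fun c => ?_)
  · rintro _ ⟨x, rfl⟩
    obtain ⟨i, -, hi⟩ := h₁ (x ()) 0
    exact ⟨_, hi _ le_rfl⟩
  simp only [key]
  refine .all hk0 (.ex hk0 (.and (.le hk0 _ _) (.and (.map (· = c) (hval _ _)) (.ex hk0 (.all hk0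
    (.imp (.le hk0 _ _) (.not (.ex hk0 (.and (.le hk0 _ _) (.and (.all hk0 (.imp (.lt hk0 _ _)
    (.map₂ (· = ·) (hval _ _) (hval _ _)))) (.or (.and (.even hk0 _) (.map₂ r (hval _ _) (hval _ _)))
    (.and (.not (.even hk0 _)) (.map₂ r (hval _ _) (hval _ _))))))))))))))
/-! ### Complete quotients -/

/-- `X t` are the complete quotients of the infinite continued fraction `X 0 = [b 0, b 1, b 2, …]`,
all of whose partial quotients are positive. -/
def IsCompleteQuotients (X : ℕ → ℝ) (b : ℕ → ℤ) : Prop :=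
  ∀ t, 1 < X t ∧ X t = b t + (X (t + 1))⁻¹

namespace IsCompleteQuotients

variable {X Y : ℕ → ℝ} {b c : ℕ → ℤ}

theorem inv_mem (h : IsCompleteQuotients X b) (t : ℕ) : 0 < (X t)⁻¹ ∧ (X t)⁻¹ < 1 := by
  have := (h t).1
  exact ⟨inv_pos.2 (by linarith), inv_lt_one_of_one_lt₀ this⟩

theorem tail (h : IsCompleteQuotients X b) :
    IsCompleteQuotients (fun t => X (t + 1)) (fun t => b (t + 1)) := fun t => h (t + 1)

theorem floor_eq (h : IsCompleteQuotients X b) (t : ℕ) : ⌊X t⌋ = b t := by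
  have := h.inv_mem (t + 1)
  rw [Int.floor_eq_iff, (h t).2]
  constructor <;> linarith

theorem fract_eq (h : IsCompleteQuotients X b) (t : ℕ) : Int.fract (X t) = (X (t + 1))⁻¹ := by
  rw [← Int.self_sub_floor, h.floor_eq, (h t).2]
  ring

theorem isPartialQuotients (h : IsCompleteQuotients X b) : IsPartialQuotients (X 0) b := by
  have hs : ∀ n, GenContFract.IntFractPair.stream (X 0) n = some ⟨b n, (X (n + 1))⁻¹⟩ := by
    intro n
    induction n with
    | zero =>
      rw [GenContFract.IntFractPair.stream_zero, GenContFract.IntFractPair.of, h.floor_eq,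
        h.fract_eq]
    | succ n ih =>
      rw [GenContFract.IntFractPair.stream_succ_of_some ih (h.inv_mem _).1.ne', inv_inv,
        GenContFract.IntFractPair.of, h.floor_eq, h.fract_eq]
  refine ⟨by rw [GenContFract.of_h_eq_floor, h.floor_eq], fun n => ?_⟩
  exact GenContFract.partDen_eq_s_b
    (GenContFract.get?_of_eq_some_of_succ_get?_intFractPair_stream (hs (n + 1)))

/-- Continued fractions compare like their partial quotients at the first index where these
differ, with the order reversed at odd indices. The induction on `t` passes to the tails, which swaps
the two sides. -/
theorem lt_of_first_diff (t : ℕ) : ∀ {X Y : ℕ → ℝ} {b c : ℕ → ℤ},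
    IsCompleteQuotients X b → IsCompleteQuotients Y c → (∀ s, s < t → b s = c s) →
    ((Even t ∧ b t < c t) ∨ (¬ Even t ∧ c t < b t)) → X 0 < Y 0 := by
  induction t with
  | zero =>
    intro X Y b c hX hY _ h
    have hlt : b 0 < c 0 := by simpa using h
    have h1 : (b 0 : ℝ) + 1 ≤ c 0 := by exact_mod_cast hlt
    rw [(hX 0).2, (hY 0).2]
    linarith [(hX.inv_mem 1).2, (hY.inv_mem 1).1]
  | succ t ih =>
    intro X Y b c hX hY hs h
    have h1 : Y 1 < X 1 := by
      refine ih hY.tail hX.tail (fun s hst => (hs (s + 1) (by omega)).symm) ?_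
      rw [Nat.even_add_one, not_not] at h
      exact h.symm
    rw [(hX 0).2, (hY 0).2, hs 0 (by omega)]
    have := (hY 1).1
    gcongr

theorem lt_of_altLT (hX : IsCompleteQuotients X b) (hY : IsCompleteQuotients Y c) {n : ℕ}
    (h : AltLT (· < ·) n b c) : X 0 < Y 0 := by
  obtain ⟨t, -, hs, ht⟩ := h
  exact lt_of_first_diff t hX hY hs ht

theorem gt_of_altLT (hX : IsCompleteQuotients X b) (hY : IsCompleteQuotients Y c) {n : ℕ}
    (h : AltLT (· > ·) n b c) : Y 0 < X 0 := by
  obtain ⟨t, -, hs, ht⟩ := h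
  exact lt_of_first_diff t hY hX (fun s hst => (hs s hst).symm) ht

end IsCompleteQuotients

/-! ### Limits of reversed continued fractions -/

/-- The recurrence of the ratios `y i = q i / q (i - 1)` of consecutive denominators of a continued
fraction with partial quotients `a`, bounded by `B`. Nothing is asked of `a 0`. -/
structure ReversedQuotients (a : ℕ → ℤ) (B : ℤ) (y : ℕ → ℝ) : Prop where
  one_le : ∀ i, 1 ≤ a (i + 1)
  le : ∀ i, a (i + 1) ≤ B
  one_le_ratio : ∀ i, 1 ≤ y i
  ratio_le : ∀ i, y i ≤ B + 1
  ratio_add_two : ∀ i, y (i + 2) = a (i + 2) + (y (i + 1))⁻¹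

/-- Along an ultrafilter tending to infinity, the reversed continued fractions `y` converge to an
infinite continued fraction, together with all their complete quotients. -/
theorem ReversedQuotients.exists_limit {a : ℕ → ℤ} {B : ℤ} {y : ℕ → ℝ}
    (h : ReversedQuotients a B y) (U : Ultrafilter ℕ) (hU : (U : Filter ℕ) ≤ atTop) :
    ∃ X b, IsCompleteQuotients X b ∧ (∀ t, Tendsto (fun i => y (i - t)) U (𝓝 (X t))) ∧
      (∀ t, ∀ᶠ i in (U : Filter ℕ), a (i - t) = b t) ∧ ∀ t, b t ∈ Set.Icc 1 B := by
  have hX : ∀ t, ∃ x ∈ Set.Icc (1 : ℝ) (B + 1), Tendsto (fun i => y (i - t)) U (𝓝 x) := by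
    intro t
    refine isCompact_Icc.ultrafilter_le_nhds (U.map fun i => y (i - t)) ?_
    exact le_principal_iff.2 (Ultrafilter.mem_map.2 (Filter.univ_mem' fun i =>
      ⟨h.one_le_ratio _, h.ratio_le _⟩))
  have hb : ∀ t, ∃ c ∈ Set.Icc 1 B, ∀ᶠ i in (U : Filter ℕ), a (i - t) = c := by
    intro t
    refine (Ultrafilter.eventually_exists_mem_iff (Set.finite_Icc 1 B)).1 ?_
    filter_upwards [hU (eventually_ge_atTop (t + 1))] with i hi
    obtain ⟨j, hj⟩ : ∃ j, i - t = j + 1 := ⟨i - t - 1, by omega⟩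
    exact ⟨_, hj ▸ ⟨h.one_le j, h.le j⟩, rfl⟩
  choose X hXm hX using hX
  choose b hbm hb using hb
  have hrec : ∀ t, X t = b t + (X (t + 1))⁻¹ := by
    intro t
    have hpos : X (t + 1) ≠ 0 := by linarith [(hXm (t + 1)).1]
    refine tendsto_nhds_unique (hX t) (((hX (t + 1)).inv₀ hpos).const_add (b t : ℝ) |>.congr' ?_)
    filter_upwards [hb t, hU (eventually_ge_atTop (t + 2))] with i hi hit
    obtain ⟨j, rfl⟩ : ∃ j, i = j + t + 2 := ⟨i - t - 2, by omega⟩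
    have e1 : j + t + 2 - t = j + 2 := by omega
    have e2 : j + t + 2 - (t + 1) = j + 1 := by omega
    rw [e1] at hi ⊢
    rw [e2, h.ratio_add_two, hi]
  refine ⟨X, b, fun t => ⟨?_, hrec t⟩, hX, hb, hbm⟩
  have h1 : (1 : ℝ) ≤ b t := by exact_mod_cast (hbm t).1
  have h2 : 0 < (X (t + 1))⁻¹ := inv_pos.2 (by linarith [(hXm (t + 1)).1])
  rw [hrec t]
  linarith

/-- A cluster point `ζ` of the ratios has an automatic continued fraction, provided it is extremal
in the sense that no expansion beyond that of `ζ` in the alternating order is that of a cluster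
point. -/
theorem ReversedQuotients.hasAutomaticContFract {k : ℕ} (hk : 2 ≤ k) {a : ℕ → ℤ} {B : ℤ}
    {y : ℕ → ℝ} (h : ReversedQuotients a B y) (ha : IsAutomatic k a)
    (r : ℤ → ℤ → Prop) (hr : ∀ x y, r x y ∨ x = y ∨ r y x) {ζ : ℝ} (hζ : MapClusterPt ζ atTop y)
    (hext : ∀ {n X b Y c}, IsCompleteQuotients X b → IsCompleteQuotients Y c → AltLT r n b c →
      X 0 = ζ → ¬ MapClusterPt (Y 0) atTop y) :
    HasAutomaticContFract k ζ := by
  obtain ⟨U, hU, hUζ⟩ := mapClusterPt_iff_ultrafilter.1 hζ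
  obtain ⟨X, b, hXb, hX, hb, hbm⟩ := h.exists_limit U hU
  obtain rfl : ζ = X 0 := tendsto_nhds_unique hUζ (hX 0)
  refine ⟨b, hXb.isPartialQuotients, ⟨B, fun n => ?_⟩, isAutomatic_of_extremal hk ha r hr ?_ ?_⟩
  · rw [abs_of_nonneg (by linarith [(hbm n).1])]
    exact (hbm n).2
  · intro n N
    have hall : ∀ᶠ i in (U : Filter ℕ), ∀ s ∈ Set.Iic n, a (i - s) = b s :=
      (Set.finite_Iic n).eventually_all.2 fun s _ => hb s
    obtain ⟨i, hi, hiN⟩ := (hall.and (hU (eventually_ge_atTop N))).exists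
    exact ⟨i, hiN, hi⟩
  · intro n
    by_contra hcon
    have hfreq : ∃ᶠ j in atTop, AltLT r n b (fun s => a (j - s)) := by
      rw [frequently_atTop]
      push Not at hcon
      exact hcon
    -- A limit along an ultrafilter `V` that lives on these indices is a cluster point beyond `X 0`.
    have := frequently_iff_neBot.1 hfreq
    let V := Ultrafilter.of (atTop ⊓ 𝓟 {j | AltLT r n b (fun s => a (j - s))})
    have hV := Ultrafilter.of_le (atTop ⊓ 𝓟 {j | AltLT r n b (fun s => a (j - s))})
    have hVtop : (V : Filter ℕ) ≤ atTop := hV.trans inf_le_left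
    obtain ⟨Y, c, hYc, hY, hc, -⟩ := h.exists_limit V hVtop
    have hall : ∀ᶠ i in (V : Filter ℕ), ∀ s ∈ Set.Iic n, a (i - s) = c s :=
      (Set.finite_Iic n).eventually_all.2 fun s _ => hc s
    obtain ⟨j, hj, hlt⟩ := (hall.and (le_principal_iff.1 (hV.trans inf_le_right))).exists
    exact hext hXb hYc (AltLT.congr (fun _ _ => rfl) hj hlt) rfl
      (mapClusterPt_iff_ultrafilter.2 ⟨V, hVtop, hY 0⟩)

theorem ReversedQuotients.isBounded {a : ℕ → ℤ} {B : ℤ}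
    {y : ℕ → ℝ} (h : ReversedQuotients a B y) :
    IsBoundedUnder (· ≤ ·) atTop y ∧ IsBoundedUnder (· ≥ ·) atTop y :=
  ⟨isBoundedUnder_of ⟨_, h.ratio_le⟩, isBoundedUnder_of ⟨_, h.one_le_ratio⟩⟩

theorem ReversedQuotients.hasAutomaticContFract_limsup {k : ℕ} (hk : 2 ≤ k) {a : ℕ → ℤ} {B : ℤ}
    {y : ℕ → ℝ} (h : ReversedQuotients a B y) (ha : IsAutomatic k a) :
    HasAutomaticContFract k (limsup y atTop) := by
  have hg := isGreatest_mapClusterPt_limsup (u := y) (f := atTop)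
    h.isBounded.2.isCoboundedUnder_le h.isBounded.1
  refine h.hasAutomaticContFract hk ha (· < ·) lt_trichotomy hg.1 ?_
  intro n X b Y c hX hY hlt hXζ hcl
  exact (hXζ ▸ hX.lt_of_altLT hY hlt).not_ge (hg.2 hcl)

theorem ReversedQuotients.hasAutomaticContFract_liminf {k : ℕ} (hk : 2 ≤ k) {a : ℕ → ℤ} {B : ℤ}
    {y : ℕ → ℝ} (h : ReversedQuotients a B y) (ha : IsAutomatic k a) :
    HasAutomaticContFract k (liminf y atTop) := by
  have hg := isLeast_mapClusterPt_liminf (u := y) (f := atTop)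
    h.isBounded.1.isCoboundedUnder_ge h.isBounded.2
  refine h.hasAutomaticContFract hk ha (· > ·) (fun x y => (lt_trichotomy y x).imp_right
    (Or.imp_left Eq.symm)) hg.1 ?_
  intro n X b Y c hX hY hlt hXζ hcl
  exact (hXζ ▸ hX.gt_of_altLT hY hlt).not_ge (hg.2 hcl)

/-- If `v - u` tends to `0` and `u` is bounded, the limsup and liminf of `v` in the extended reals
are those of `u` in `ℝ`, because `u` and `v` have the same cluster points. -/
theorem limsup_liminf_coe_eq {u v : ℕ → ℝ} (hu : IsBoundedUnder (· ≤ ·) atTop u)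
    (hu' : IsBoundedUnder (· ≥ ·) atTop u) (huv : Tendsto (fun n => v n - u n) atTop (𝓝 0)) :
    limsup (fun n => (v n : EReal)) atTop = (limsup u atTop : ℝ) ∧
      liminf (fun n => (v n : EReal)) atTop = (liminf u atTop : ℝ) := by
  have hadd : v = u + fun n => v n - u n := by
    funext n
    simp
  have hv : IsBoundedUnder (· ≤ ·) atTop v := by
    rw [hadd]
    exact isBoundedUnder_le_add hu huv.isBoundedUnder_le
  have hv' : IsBoundedUnder (· ≥ ·) atTop v := by
    rw [hadd]
    exact isBoundedUnder_ge_add hu' huv.isBoundedUnder_ge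
  have hcl : ∀ x, MapClusterPt x atTop v ↔ MapClusterPt x atTop u := by
    intro x
    simp only [mapClusterPt_iff_ultrafilter]
    refine exists_congr fun U => and_congr_right fun hU => ⟨fun h => ?_, fun h => ?_⟩
    · simpa using h.sub (huv.mono_left hU)
    · simpa using h.add (huv.mono_left hU)
  have hmono : Monotone ((↑) : ℝ → EReal) := fun _ _ h => EReal.coe_le_coe_iff.2 h
  have hsup := hmono.map_limsup_of_continuousAt v continuous_coe_real_ereal.continuousAt hv
    hv'.isCoboundedUnder_le
  have hinf := hmono.map_liminf_of_continuousAt v continuous_coe_real_ereal.continuousAt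
    hv.isCoboundedUnder_ge hv'
  have hg := isGreatest_mapClusterPt_limsup hv'.isCoboundedUnder_le hv
  have hl := isLeast_mapClusterPt_liminf hv.isCoboundedUnder_ge hv'
  simp only [hcl] at hg hl
  rw [(isGreatest_mapClusterPt_limsup hu'.isCoboundedUnder_le hu).unique hg,
    (isLeast_mapClusterPt_liminf hu.isCoboundedUnder_ge hu').unique hl]
  exact ⟨hsup.symm, hinf.symm⟩

/-! ### Convergents -/

theorem IsPartialQuotients.reversedQuotients {α : ℝ} {a : ℕ → ℤ} (h : IsPartialQuotients α a)
    {B : ℤ} (hB : ∀ n, |a n| ≤ B) : ReversedQuotients a B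
      (fun i => (GenContFract.of α).dens i / (GenContFract.of α).dens (i - 1)) := by
  set q := (GenContFract.of α).dens with hq
  have hle : ∀ i, a i ≤ B := fun i => (abs_le.1 (hB i)).2
  have hone : ∀ i, 1 ≤ a (i + 1) := fun i => by
    exact_mod_cast GenContFract.of_one_le_get?_partDen (h.2 i)
  have hs : ∀ i, (GenContFract.of α).s.get? i = some ⟨1, a (i + 1)⟩ := by
    intro i
    obtain ⟨gp, hgp, hb⟩ := GenContFract.exists_s_b_of_partDen (h.2 i)
    rw [hgp, ← hb, ← (GenContFract.of_partNum_eq_one_and_exists_int_partDen_eq hgp).1]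
  have hq0 : q 0 = 1 := GenContFract.zeroth_den_eq_one
  have hq1 : q 1 = a 1 := GenContFract.first_den_eq (hs 0)
  have hq2 : ∀ i, q (i + 2) = a (i + 2) * q (i + 1) + q i := fun i => by
    simpa using GenContFract.dens_recurrence (hs (i + 1)) rfl rfl
  have hone' : ∀ i, (1 : ℝ) ≤ a (i + 1) := fun i => by exact_mod_cast hone i
  have hle' : ∀ i, (a i : ℝ) ≤ B := fun i => by exact_mod_cast hle i
  have hpos : ∀ i, 0 < q i ∧ q i ≤ q (i + 1) := by
    intro i
    induction i with
    | zero => rw [hq0, hq1]; exact ⟨one_pos, hone' 0⟩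
    | succ i ih =>
      have : 0 < q (i + 1) := ih.1.trans_le ih.2
      refine ⟨this, ?_⟩
      rw [hq2]
      nlinarith [hone' (i + 1), ih.1]
  have hrec : ∀ i, q (i + 2) / q (i + 1) = a (i + 2) + (q (i + 1) / q i)⁻¹ := by
    intro i
    have := (hpos (i + 1)).1
    rw [hq2, add_div, mul_div_cancel_right₀ _ this.ne', inv_div]
  have hge : ∀ i, 1 ≤ q i / q (i - 1) := by
    intro i
    rw [one_le_div (hpos _).1]
    cases i with
    | zero => exact le_rfl
    | succ i => exact (hpos i).2
  refine ⟨hone, fun i => hle _, hge, fun i => ?_, hrec⟩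
  match i with
  | 0 => simpa [hq0] using zero_le_one.trans ((hone 0).trans (hle 1))
  | 1 => simpa [hq0, hq1] using (hle' 1).trans (lt_add_one (B : ℝ)).le
  | i + 2 =>
    have := inv_le_one_of_one_le₀ (hge (i + 1))
    simp only [Nat.add_one_sub_one] at this ⊢
    rw [hrec]
    linarith [hle' (i + 2)]

/-- The ratio of consecutive numerators is the ratio of consecutive denominators times the ratio
of consecutive convergents, which tends to `1`. -/
theorem tendsto_nums_ratio_sub_dens_ratio {α : ℝ} (hα : α ≠ 0)
    (hpos : ∀ n, (GenContFract.of α).dens n ≠ 0)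
    (hbdd : IsBoundedUnder (· ≤ ·) atTop fun n =>
      |(GenContFract.of α).dens (n + 1) / (GenContFract.of α).dens n|) :
    Tendsto (fun n => (GenContFract.of α).nums (n + 1) / (GenContFract.of α).nums n -
      (GenContFract.of α).dens (n + 1) / (GenContFract.of α).dens n) atTop (𝓝 0) := by
  have hc := GenContFract.of_convergence α
  have h1 : Tendsto (fun n => (GenContFract.of α).convs (n + 1) / (GenContFract.of α).convs n - 1)
      atTop (𝓝 0) := by
    have := (((tendsto_add_atTop_iff_nat 1).2 hc).div hc hα).sub_const 1
    rwa [div_self hα, sub_self] at this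
  refine (h1.zero_mul_isBoundedUnder_le hbdd).congr fun n => ?_
  rw [GenContFract.conv_eq_num_div_den, GenContFract.conv_eq_num_div_den]
  have hn := hpos n
  have hn1 := hpos (n + 1)
  by_cases h0 : (GenContFract.of α).nums n = 0
  -- Both sides agree also when a numerator vanishes, since division by zero gives zero.
  · simp [h0]
  · field_simp

theorem theorem7 (k : ℕ) (hk : 2 ≤ k) (α : ℝ) (hα : Irrational α)
    (hcf : HasAutomaticContFract k α) (p q : ℕ → ℝ)
    (hp : p = (GenContFract.of α).nums) (hq : q = (GenContFract.of α).dens) :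
    ∃ β γ δ ζ : ℝ,
      liminf (fun n : ℕ => ((p (n + 1) / p n : ℝ) : EReal)) atTop = (β : EReal) ∧
      liminf (fun n : ℕ => ((q (n + 1) / q n : ℝ) : EReal)) atTop = (γ : EReal) ∧
      limsup (fun n : ℕ => ((p (n + 1) / p n : ℝ) : EReal)) atTop = (δ : EReal) ∧
      limsup (fun n : ℕ => ((q (n + 1) / q n : ℝ) : EReal)) atTop = (ζ : EReal) ∧
      HasAutomaticContFract k β ∧ HasAutomaticContFract k γ ∧
      HasAutomaticContFract k δ ∧ HasAutomaticContFract k ζ := by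
  subst hp hq
  obtain ⟨a, haα, ⟨B, hB⟩, ha⟩ := hcf
  set q := (GenContFract.of α).dens
  have h := haα.reversedQuotients hB
  set y : ℕ → ℝ := fun i => q i / q (i - 1) with hy
  have hle : IsBoundedUnder (· ≤ ·) atTop fun n => q (n + 1) / q n :=
    isBoundedUnder_of ⟨_, fun n => h.ratio_le (n + 1)⟩
  have hge : IsBoundedUnder (· ≥ ·) atTop fun n => q (n + 1) / q n :=
    isBoundedUnder_of ⟨_, fun n => h.one_le_ratio (n + 1)⟩
  have hne : ∀ n, q n ≠ 0 := by
    intro n h0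
    have := h.one_le_ratio (n + 1)
    norm_num [hy, h0] at this
  have hq := limsup_liminf_coe_eq hle hge (v := fun n => q (n + 1) / q n) (by simp)
  have hp := limsup_liminf_coe_eq hle hge (tendsto_nums_ratio_sub_dens_ratio hα.ne_zero hne
    (isBoundedUnder_of ⟨B + 1, fun n => abs_le.2 ⟨?_, h.ratio_le (n + 1)⟩⟩))
  · have hsup : limsup (fun n => q (n + 1) / q n) atTop = limsup y atTop := limsup_nat_add y 1
    have hinf : liminf (fun n => q (n + 1) / q n) atTop = liminf y atTop := liminf_nat_add y 1
    rw [hsup, hinf] at hq hp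
    exact ⟨_, _, _, _, hp.2, hq.2, hp.1, hq.1, h.hasAutomaticContFract_liminf hk ha,
      h.hasAutomaticContFract_liminf hk ha, h.hasAutomaticContFract_limsup hk ha,
      h.hasAutomaticContFract_limsup hk ha⟩
  · have := h.one_le_ratio (n + 1)
    have := h.ratio_le (n + 1)
    simp only [hy, Nat.add_one_sub_one] at *
    linarith
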